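/- **Setting.** A finite $N$-player sequential game with imperfect information consists of a finite tree of histories $H$ with root $h_{\rm init}$, where each non-terminal history belongs to one of the players $1,\dots,N$ or to chance; $\tau(h)$ denotes the player to move at $h$ (or chance). A player who moves at $h$ observes an information state $x(h)$; the set $\mathcal X_i$ of information states of player $i$ is finite, and the non-empty finite set $A(x)$ of available actions depends on $h$ only through $x=x(h)$. If $a$ is played at $h$, the game moves to the history $ha$ and each player $i$ receives a reward $r^i(h,a)\in\mathbb R$. Chance plays each of its actions at $h$ with a fixed positive probability. The game has perfect recall: any two histories in the same $x\in\mathcal X_i$ are preceded by the same sequence of information states and actions of player $i$. A (joint) policy $\pi$ assigns to every information state $x$ of a player a probability distribution $\pi(\cdot|x)$ on $A(x)$; at chance histories $\pi(\cdot|x(h))$ stands for the fixed distribution of chance. $\pi$ is interior if $\pi(a|x)>0$ for all $x$ and $a\in A(x)$. $(\mu^i,\pi^{-i})$ is the policy equal to $\mu$ on $\mathcal X_i$ and to $\pi$ elsewhere. Let $\rho^\pi(h)=\prod_{h'a\sqsubseteq h}\pi(a|x(h'))$ be the reach probability of $h$, and let $\rho^{\pi^{-i}}(h)$ be the same product over those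 $h'$ with $\tau(h')\ne i$. For a reward $r^i_\pi(h,a)$, which may depend on the policy, let $$V^i_\pi=\sum_{h\in H}\rho^\pi(h)\sum_a\pi(a|x(h))\,r^i_\pi(h,a)$$ be the expected total reward of player $i$. A policy $\pi$ is a Nash equilibrium if $V^i_{\pi'^i,\pi^{-i}}\le V^i_\pi$ for all $i$ and all policies $\pi'$. The game with reward $r$ is monotone if for all policies $\pi\ne\mu$ $$\sum_{i=1}^N\Big(V^i_{\pi}-V^i_{\mu^i,\pi^{-i}}-V^i_{\pi^i,\mu^{-i}}+V^i_{\mu}\Big)\le 0 .$$ **Theorem.** Let a game as above, with policy-independent reward $r$, be monotone, and suppose that all of its Nash equilibria are interior. Let $\eta>0$. For an interior policy $\mu$ consider the transformed game with reward $$r^i_{\mu,\pi}(h,a)=r^i(h,a)-\frac{\eta\,\mathbf 1_{i=\tau(h)}}{\rho^{\pi^{-i}}(h)}\log\frac{\pi(a|x(h))}{\mu(a|x(h))}$$ (where $\rho^{\pi^{-i}}(h)=0$ the second term, whose weight $\rho^\pi(h)$ in the value is $0$, is dropped; and $0\log 0=0$). Then for every interior $\mu$ the transformed game has exactly one Nash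 equilibrium $F(\mu)$, and $F(\mu)$ is interior. Moreover, if $\pi_0$ is the uniform policy (uniform on $A(x)$ for every $x$) and $\pi_k=F(\pi_{k-1})$ for $k\ge 1$, then there is a Nash equilibrium $\pi^*$ of the original game (with reward $r$) such that $\pi_k\to\pi^*$ as $k\to\infty$. -/

import Mathlib

open Filter Topology

/-- A finite `N`-player sequential game with imperfect information and a chance player.
`ι` is the set of players, `X` the set of information states of the players, `A` the set of
actions. A history is the list of the actions played so far, the most recent one first: `[]` is
the initial history and `a :: h` is the history reached from `h` by action `a`. -/
structure SeqGame (ι X A : Type*) [Fintype ι] [DecidableEq ι] [Fintype X] [Fintype A]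
    [DecidableEq A] where
  /-- the finite set of histories -/
  hist : Finset (List A)
  nil_mem : [] ∈ hist
  prefix_mem : ∀ a h, a :: h ∈ hist → h ∈ hist
  /-- the information state observed by the player whose turn it is at a history; `none` if it
  is the turn of chance or if the history is terminal -/
  info : List A → Option X
  /-- the player who observes an information state -/
  owner : X → ι
  /-- the actions available at an information state -/
  legal : X → Finset A
  legal_nonempty : ∀ x, (legal x).Nonempty
  /-- exactly the available actions lead to a new history -/
  mem_legal_iff : ∀ h ∈ hist, ∀ x, info h = some x → ∀ a, a ∈ legal x ↔ a :: h ∈ hist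
  /-- every information state occurs in the game -/
  info_surj : ∀ x, ∃ h ∈ hist, info h = some x
  /-- the fixed probabilities with which chance plays -/
  chance : List A → A → ℝ
  chance_pos : ∀ h ∈ hist, info h = none → ∀ a, a :: h ∈ hist → 0 < chance h a
  chance_sum : ∀ h ∈ hist, info h = none → (∃ a, a :: h ∈ hist) →
    ∑ a with a :: h ∈ hist, chance h a = 1
  /-- the (policy-independent) reward of each player for action `a` at history `h` -/
  reward : ι → List A → A → ℝ

namespace SeqGame

variable {ι X A : Type*} [Fintype ι] [DecidableEq ι] [Fintype X] [Fintype A] [DecidableEq A]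
  (G : SeqGame ι X A)

/-- The actions that can be played at a history (none at a terminal history). -/
def acts (h : List A) : Finset A := {a | a :: h ∈ G.hist}

/-- The player whose turn it is; `none` if it is the turn of chance or if `h` is terminal. -/
def turn (h : List A) : Option ι := (G.info h).map G.owner

/-- A joint (behavioural) policy of the players: at every information state a probability
distribution on the available actions. The topology is that of `X → A → ℝ`. -/
abbrev Policy : Type _ :=
  {π : X → A → ℝ // ∀ x, π x ∈ stdSimplex ℝ A ∧ ∀ a ∉ G.legal x, π x a = 0}

variable {G}

/-- The joint policy `(μ^i, π^{-i})`: player `i` uses `μ`, everybody else uses `π`. -/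
def Policy.deviate (π : G.Policy) (i : ι) (μ : G.Policy) : G.Policy :=
  ⟨fun x => if G.owner x = i then μ.1 x else π.1 x, fun x => by
    by_cases hx : G.owner x = i
    · simpa [hx] using μ.2 x
    · simpa [hx] using π.2 x⟩

/-- A policy is interior if it gives positive probability to every available action. -/
def Policy.Interior (π : G.Policy) : Prop := ∀ x, ∀ a ∈ G.legal x, 0 < π.1 x a

/-- The probability of playing `a` at `h` under `π` (and under the fixed policy of chance). -/
def Policy.prob (π : G.Policy) (h : List A) (a : A) : ℝ :=
  match G.info h with
  | some x => π.1 x a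
  | none => G.chance h a

/-- The reach probability `ρ^π(h)`, chance included. -/
def Policy.reach (π : G.Policy) : List A → ℝ
  | [] => 1
  | a :: h => π.reach h * π.prob h a

/-- The reach probability `ρ^{π^{-i}}(h)`: the product over all steps on the way to `h` at which
it is not the turn of player `i`, steps of chance included. -/
def Policy.reachOpp (π : G.Policy) (i : ι) : List A → ℝ
  | [] => 1
  | a :: h => π.reachOpp i h * if G.turn h = some i then 1 else π.prob h a

variable (G)

/-- The policy that is uniform on the available actions. -/
noncomputable def uniform : G.Policy :=
  ⟨fun x a => if a ∈ G.legal x then ((G.legal x).card : ℝ)⁻¹ else 0, fun x => by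
    have hc : ((G.legal x).card : ℝ) ≠ 0 := by
      exact_mod_cast (Finset.card_pos.mpr (G.legal_nonempty x)).ne'
    refine ⟨⟨fun a => ?_, ?_⟩, fun a ha => by simp [ha]⟩
    · dsimp only
      split_ifs <;> positivity
    · simp [Finset.sum_ite_mem, hc]⟩

/-- `value G r π i` is the value `V^i_π` at the initial history for the policy-dependent reward
`r`, i.e. the expected total reward of player `i` when `π` is played. -/
def value (r : G.Policy → ι → List A → A → ℝ) (π : G.Policy) (i : ι) : ℝ :=
  ∑ h ∈ G.hist, π.reach h * ∑ a ∈ G.acts h, π.prob h a * r π i h a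

/-- `π` is a Nash equilibrium of the game with the policy-dependent reward `r`. -/
def IsNash (r : G.Policy → ι → List A → A → ℝ) (π : G.Policy) : Prop :=
  ∀ i, ∀ π' : G.Policy, G.value r (π.deviate i π') i ≤ G.value r π i

/-- The reward of the original game. -/
def baseReward : G.Policy → ι → List A → A → ℝ := fun _ => G.reward

/-- The transformed reward
`r^i_π(h, a) = r^i(h, a) - 1_{i = τ(h)} (η / ρ^{π^{-i}}(h)) log (π(a|x(h)) / μ(a|x(h)))`. -/
noncomputable def regReward (η : ℝ) (μ : G.Policy) : G.Policy → ι → List A → A → ℝ :=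
  fun π i h a => G.reward i h a -
    if G.turn h = some i then
      η / π.reachOpp i h * Real.log (π.prob h a / μ.prob h a)
    else 0

/-- `Ω^i(π, μ)`. -/
def omega (i : ι) (π μ : G.Policy) : ℝ :=
  G.value G.baseReward π i - G.value G.baseReward (π.deviate i μ) i
    - G.value G.baseReward (μ.deviate i π) i + G.value G.baseReward μ i

/-- The monotonicity condition. -/
def Monotone : Prop := ∀ π μ : G.Policy, π ≠ μ → ∑ i, G.omega i π μ ≤ 0

/-- The information states of player `i` passed on the way to `h`, each with the action that
player `i` played there, the most recent one first. -/
def ownPast (i : ι) : List A → List (X × A)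
  | [] => []
  | a :: h =>
    match G.info h with
    | some x => if G.owner x = i then (x, a) :: ownPast i h else ownPast i h
    | none => ownPast i h

/-- Perfect recall: at an information state a player knows all own earlier information states
and actions. -/
def PerfectRecall : Prop :=
  ∀ x, ∀ h ∈ G.hist, ∀ h' ∈ G.hist, G.info h = some x → G.info h' = some x →
    G.ownPast (G.owner x) h = G.ownPast (G.owner x) h'

end SeqGame

/-!
Under perfect recall the weights `infoReach π x * π x a` of a player's policy determine the
distribution over that player's actions, and they mix: for every convex combination of policies
some policy realizes the combination of the weights (`Policy.exists_isMixture`). A player's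
expected reward is affine under mixtures of the player's own policy. The factor
`1 / ρ^{π^{-i}}` cancels in the expectation, so at an interior policy the transformed game
subtracts from the reward of player `i` the quantity `η * D i μ`, where `D i` is a weighted sum of
Kullback-Leibler divergences at the information states of `i` (`Policy.div`,
`Policy.value_regReward_deviate`). Mixtures satisfy a compensation identity
(`Policy.IsMixture.sum_div`): the mean divergence from `μ` is the divergence of the mixture from
`μ` plus the mean divergence from the mixture.

If player `i`'s part of `π` is optimal in the transformed game, comparing `π` with mixtures of `π`
and `ν` in which the weight of `ν` tends to zero gives two things. First, `π` gives positive
probability to all actions wherever it can be reached (`Policy.IsRegBestResponse.pos`), hence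
transformed equilibria are interior. At a non-interior `π` the transformed game regularizes only
the histories with `ρ^{π^{-i}} ≠ 0`, which is why this step allows weights that depend on `π`.
Secondly, the gain of `i` from moving to `ν` is at most
`η * (D i ν μ - D i π μ - D i ν π)` (`Policy.IsRegBestResponse.value_sub_le`).

Added up for two transformed equilibria, the second fact and monotonicity force the divergence
between them to vanish, which is uniqueness. Existence needs no fixed point theorem: a policy is an
equilibrium if, for each `ν`, the players' separate moves from `ν` to it do not lower the total
regularized value. For finitely many `ν` a mixture of them does it, by a minimax argument for
matrices with `M + Mᵀ ≥ 0`, and the policies form a compact space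
(`Monotone.exists_isRegBestResponse`). With `η = 0` this gives a Nash equilibrium of the original
game as well.

For the iteration, the second fact shows `D(ν, π_{k+1}) ≤ D(ν, π_k) - D(π_{k+1}, π_k)` for each
Nash equilibrium `ν` of the original game. As `ν` is interior and the divergence stays bounded, all
cluster points of the iteration are interior; since the steps tend to zero in divergence, the
variational inequalities pass to the limit along a subsequence, and their right-hand sides
vanish there. So some cluster point is itself a Nash equilibrium `ν`, and then `D(ν, π_k)`
decreases to zero, which forces convergence of the whole sequence (`Monotone.exists_tendsto`).
-/

namespace SeqGame

variable {ι X A : Type*} [Fintype ι] [DecidableEq ι] [Fintype X] [Fintype A] [DecidableEq A]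
  {G : SeqGame ι X A}

/-! ### Own sequences and realization weights -/

theorem Policy.nonneg (π : G.Policy) (x : X) (a : A) : 0 ≤ π.1 x a := (π.2 x).1.1 a

theorem Policy.eq_zero (π : G.Policy) {x : X} {a : A} (ha : a ∉ G.legal x) : π.1 x a = 0 :=
  (π.2 x).2 a ha

theorem Policy.sum_legal (π : G.Policy) (x : X) : ∑ a ∈ G.legal x, π.1 x a = 1 := by
  rw [← (π.2 x).1.2]
  exact Finset.sum_subset (Finset.subset_univ _) fun a _ ha => π.eq_zero ha

/-- The probability with which `π` plays all actions of a sequence of information states and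
actions. -/
def Policy.seqProb (π : G.Policy) (l : List (X × A)) : ℝ := (l.map fun p => π.1 p.1 p.2).prod

theorem Policy.seqProb_nonneg (π : G.Policy) (l : List (X × A)) : 0 ≤ π.seqProb l := by
  refine List.prod_nonneg fun y hy => ?_
  obtain ⟨p, -, rfl⟩ := List.mem_map.1 hy
  exact π.nonneg _ _

@[simp] theorem Policy.seqProb_nil (π : G.Policy) : π.seqProb [] = 1 := by simp [seqProb]

@[simp] theorem Policy.seqProb_cons (π : G.Policy) (x : X) (a : A) (l : List (X × A)) :
    π.seqProb ((x, a) :: l) = π.1 x a * π.seqProb l := by simp [seqProb]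

theorem ownPast_cons_of_owner {i : ι} {h : List A} {x : X} (hx : G.info h = some x)
    (hi : G.owner x = i) (a : A) : G.ownPast i (a :: h) = (x, a) :: G.ownPast i h := by
  simp [ownPast, hx, hi]

theorem ownPast_cons_of_turn_ne {i : ι} {h : List A} (hi : G.turn h ≠ some i) (a : A) :
    G.ownPast i (a :: h) = G.ownPast i h := by
  cases hx : G.info h with
  | none => simp [ownPast, hx]
  | some x =>
    have : G.owner x ≠ i := by simpa [turn, hx] using hi
    simp [ownPast, hx, this]

theorem turn_eq_some_iff {i : ι} {h : List A} :
    G.turn h = some i ↔ ∃ x, G.info h = some x ∧ G.owner x = i := by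
  simp [turn]

theorem owner_of_mem_ownPast {i : ι} {h : List A} {p : X × A} (hp : p ∈ G.ownPast i h) :
    G.owner p.1 = i := by
  induction h with
  | nil => simp [ownPast] at hp
  | cons a h ih =>
    by_cases ht : G.turn h = some i
    · obtain ⟨x, hx, hi⟩ := turn_eq_some_iff.1 ht
      rw [ownPast_cons_of_owner hx hi, List.mem_cons] at hp
      rcases hp with rfl | hp
      · exact hi
      · exact ih hp
    · rw [ownPast_cons_of_turn_ne ht] at hp
      exact ih hp

theorem Policy.seqProb_congr {π σ : G.Policy} {l : List (X × A)}
    (hl : ∀ p ∈ l, π.1 p.1 = σ.1 p.1) : π.seqProb l = σ.seqProb l := by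
  unfold seqProb
  rw [List.map_congr_left fun p hp => by rw [hl p hp]]

theorem Policy.reach_eq (π : G.Policy) (i : ι) (h : List A) :
    π.reach h = π.reachOpp i h * π.seqProb (G.ownPast i h) := by
  induction h with
  | nil => simp [reach, reachOpp, ownPast]
  | cons a h ih =>
    by_cases ht : G.turn h = some i
    · obtain ⟨x, hx, hi⟩ := turn_eq_some_iff.1 ht
      rw [ownPast_cons_of_owner hx hi]
      simp only [reach, reachOpp, ih, seqProb_cons, ht, if_true, prob, hx]
      ring
    · rw [ownPast_cons_of_turn_ne ht]
      simp only [reach, reachOpp, ih, ht, if_false]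
      ring

variable (G) in
/-- The own information states and actions that precede the information state `x`, read off at
one representative history. Under perfect recall the choice of the representative does not
matter. -/
noncomputable def past (x : X) : List (X × A) := G.ownPast (G.owner x) (G.info_surj x).choose

theorem PerfectRecall.ownPast_eq (hrecall : G.PerfectRecall) {h : List A} (hh : h ∈ G.hist)
    {x : X} (hx : G.info h = some x) : G.ownPast (G.owner x) h = G.past x :=
  hrecall x h hh _ (G.info_surj x).choose_spec.1 hx (G.info_surj x).choose_spec.2

/-- The contribution of the owner of `x` to the probability of reaching `x`. -/
noncomputable def Policy.infoReach (π : G.Policy) (x : X) : ℝ := π.seqProb (G.past x)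

theorem Policy.infoReach_nonneg (π : G.Policy) (x : X) : 0 ≤ π.infoReach x := π.seqProb_nonneg _

theorem Policy.infoReach_congr {π σ : G.Policy} {x : X}
    (hx : ∀ y, G.owner y = G.owner x → π.1 y = σ.1 y) : π.infoReach x = σ.infoReach x :=
  seqProb_congr fun _ hp => hx _ (owner_of_mem_ownPast hp)

theorem Policy.deviate_of_owner (π σ : G.Policy) {i : ι} {x : X} (hx : G.owner x = i) :
    (π.deviate i σ).1 x = σ.1 x := by simp [deviate, hx]

theorem Policy.deviate_of_owner_ne (π σ : G.Policy) {i : ι} {x : X} (hx : G.owner x ≠ i) :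
    (π.deviate i σ).1 x = π.1 x := by simp [deviate, hx]

theorem Policy.deviate_eq_left {π σ : G.Policy} {i : ι}
    (h : ∀ x, G.owner x = i → σ.1 x = π.1 x) : π.deviate i σ = π := by
  apply Subtype.ext
  funext x
  by_cases hx : G.owner x = i
  · rw [deviate_of_owner _ _ hx, h x hx]
  · rw [deviate_of_owner_ne _ _ hx]

theorem Policy.deviate_self (π : G.Policy) (i : ι) : π.deviate i π = π :=
  deviate_eq_left fun _ _ => rfl

theorem Policy.deviate_deviate_self (π σ : G.Policy) (i : ι) :
    (π.deviate i σ).deviate i π = π := by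
  apply Subtype.ext
  funext x
  by_cases hx : G.owner x = i
  · rw [deviate_of_owner _ _ hx]
  · rw [deviate_of_owner_ne _ _ hx, deviate_of_owner_ne _ _ hx]

theorem Policy.prob_deviate_of_turn_ne (π σ : G.Policy) {i : ι} {h : List A}
    (ht : G.turn h ≠ some i) (a : A) : (π.deviate i σ).prob h a = π.prob h a := by
  cases hx : G.info h with
  | none => simp [prob, hx]
  | some x =>
    have : G.owner x ≠ i := by simpa [turn, hx] using ht
    simp [prob, hx, deviate_of_owner_ne _ _ this]

theorem Policy.reachOpp_deviate (π σ : G.Policy) (i : ι) (h : List A) :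
    (π.deviate i σ).reachOpp i h = π.reachOpp i h := by
  induction h with
  | nil => rfl
  | cons a h ih =>
    by_cases ht : G.turn h = some i
    · simp [reachOpp, ih, ht]
    · simp [reachOpp, ih, ht, prob_deviate_of_turn_ne _ _ ht]

theorem Policy.seqProb_deviate (π σ : G.Policy) (i : ι) (h : List A) :
    (π.deviate i σ).seqProb (G.ownPast i h) = σ.seqProb (G.ownPast i h) :=
  seqProb_congr fun _ hp => deviate_of_owner _ _ (owner_of_mem_ownPast hp)

theorem Policy.value_deviate (r : G.Policy → ι → List A → A → ℝ) (π σ : G.Policy) (i : ι) :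
    G.value r (π.deviate i σ) i = ∑ h ∈ G.hist, ∑ a ∈ G.acts h, π.reachOpp i h *
      (σ.seqProb (G.ownPast i h) * (π.deviate i σ).prob h a) * r (π.deviate i σ) i h a := by
  unfold value
  refine Finset.sum_congr rfl fun h _ => ?_
  rw [reach_eq _ i, reachOpp_deviate, seqProb_deviate, Finset.mul_sum]
  exact Finset.sum_congr rfl fun a _ => by ring

theorem acts_eq_legal {h : List A} (hh : h ∈ G.hist) {x : X} (hx : G.info h = some x) :
    G.acts h = G.legal x := by
  ext a
  simp [acts, G.mem_legal_iff h hh x hx a]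

theorem Policy.Interior.prob_pos {π : G.Policy} (hπ : π.Interior) {h : List A} {a : A}
    (hah : a :: h ∈ G.hist) : 0 < π.prob h a := by
  have hh := G.prefix_mem a h hah
  cases hx : G.info h with
  | none => simpa [prob, hx] using G.chance_pos h hh hx a hah
  | some x => simpa [prob, hx] using hπ x a ((G.mem_legal_iff h hh x hx a).2 hah)

theorem Policy.Interior.reachOpp_pos {π : G.Policy} (hπ : π.Interior) (i : ι) {h : List A}
    (hh : h ∈ G.hist) : 0 < π.reachOpp i h := by
  induction h with
  | nil => simp [reachOpp]
  | cons a h ih =>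
    have h1 := ih (G.prefix_mem a h hh)
    have h2 := hπ.prob_pos hh
    simp only [reachOpp]
    split_ifs <;> positivity

theorem Policy.Interior.reach_pos {π : G.Policy} (hπ : π.Interior) {h : List A}
    (hh : h ∈ G.hist) : 0 < π.reach h := by
  induction h with
  | nil => simp [reach]
  | cons a h ih => exact mul_pos (ih (G.prefix_mem a h hh)) (hπ.prob_pos hh)

theorem Policy.infoReach_pos_of_reach_ne_zero (hrecall : G.PerfectRecall) {π : G.Policy}
    {h : List A} (hh : h ∈ G.hist) {x : X} (hx : G.info h = some x) (hr : π.reach h ≠ 0) :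
    0 < π.infoReach x := by
  rw [reach_eq _ (G.owner x), hrecall.ownPast_eq hh hx] at hr
  exact lt_of_le_of_ne (π.infoReach_nonneg x) (right_ne_zero_of_mul hr).symm

theorem Policy.Interior.infoReach_pos (hrecall : G.PerfectRecall) {π : G.Policy}
    (hπ : π.Interior) (x : X) : 0 < π.infoReach x := by
  obtain ⟨h, hh, hx⟩ := G.info_surj x
  exact infoReach_pos_of_reach_ne_zero hrecall hh hx (hπ.reach_pos hh).ne'

/-! ### Mixtures of policies -/

/-- `σ` is a behavioural policy that realizes the mixture of the policies `ν k` with weights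
`lam k`: at `x` it plays `ν k` with the conditional probability of `ν k` given that the own
actions lead to `x`. Where `x` has weight zero, `σ` is arbitrary. -/
def Policy.IsMixture {κ : Type*} [Fintype κ] (lam : κ → ℝ) (ν : κ → G.Policy) (σ : G.Policy) :
    Prop :=
  ∀ x a, (∑ k, lam k * (ν k).infoReach x) * σ.1 x a =
    ∑ k, lam k * ((ν k).infoReach x * (ν k).1 x a)

section Mixture

variable {κ : Type*} [Fintype κ] {lam : κ → ℝ} {ν : κ → G.Policy} {σ : G.Policy}

theorem Policy.exists_isMixture (hlam : lam ∈ stdSimplex ℝ κ) (ν : κ → G.Policy) :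
    ∃ σ, IsMixture lam ν σ := by
  have key : ∀ x, ∃ p : A → ℝ, (p ∈ stdSimplex ℝ A ∧ ∀ a ∉ G.legal x, p a = 0) ∧
      ∀ a, (∑ k, lam k * (ν k).infoReach x) * p a =
        ∑ k, lam k * ((ν k).infoReach x * (ν k).1 x a) := by
    intro x
    have hnn : ∀ k, 0 ≤ lam k * (ν k).infoReach x := fun k =>
      mul_nonneg (hlam.1 k) ((ν k).infoReach_nonneg x)
    by_cases hS : ∑ k, lam k * (ν k).infoReach x = 0
    · refine ⟨G.uniform.1 x, G.uniform.2 x, fun a => ?_⟩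
      rw [hS, zero_mul]
      refine (Finset.sum_eq_zero fun k hk => ?_).symm
      rw [← mul_assoc, (Finset.sum_eq_zero_iff_of_nonneg fun k _ => hnn k).1 hS k hk, zero_mul]
    · refine ⟨fun a => (∑ k, lam k * ((ν k).infoReach x * (ν k).1 x a)) /
        ∑ k, lam k * (ν k).infoReach x, ⟨⟨fun a => ?_, ?_⟩, fun a ha => ?_⟩, fun a => ?_⟩
      · refine div_nonneg (Finset.sum_nonneg fun k _ => ?_) (Finset.sum_nonneg fun k _ => hnn k)
        rw [← mul_assoc]
        exact mul_nonneg (hnn k) ((ν k).nonneg x a)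
      · rw [← Finset.sum_div, div_eq_one_iff_eq hS, Finset.sum_comm]
        refine Finset.sum_congr rfl fun k _ => ?_
        rw [← Finset.mul_sum, ← Finset.mul_sum, ((ν k).2 x).1.2, mul_one]
      · simp [fun k => (ν k).eq_zero ha]
      · field_simp
  choose p hp hp' using key
  exact ⟨⟨p, hp⟩, hp'⟩

theorem Policy.IsMixture.seqProb_eq (hrecall : G.PerfectRecall) (hlam : ∑ k, lam k = 1)
    (hσ : IsMixture lam ν σ) (i : ι) {h : List A} (hh : h ∈ G.hist) :
    σ.seqProb (G.ownPast i h) = ∑ k, lam k * (ν k).seqProb (G.ownPast i h) := by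
  induction h with
  | nil => simp [ownPast, hlam]
  | cons a h ih =>
    have hh' := G.prefix_mem a h hh
    by_cases ht : G.turn h = some i
    · obtain ⟨x, hx, rfl⟩ := turn_eq_some_iff.1 ht
      have h1 := ih hh'
      rw [ownPast_cons_of_owner hx rfl]
      simp only [seqProb_cons]
      rw [h1, hrecall.ownPast_eq hh' hx, mul_comm]
      refine (hσ x a).trans (Finset.sum_congr rfl fun k _ => ?_)
      rw [infoReach]
      ring
    · rw [ownPast_cons_of_turn_ne ht]
      exact ih hh'

theorem Policy.IsMixture.infoReach_eq (hrecall : G.PerfectRecall) (hlam : ∑ k, lam k = 1)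
    (hσ : IsMixture lam ν σ) (x : X) : σ.infoReach x = ∑ k, lam k * (ν k).infoReach x :=
  hσ.seqProb_eq hrecall hlam _ (G.info_surj x).choose_spec.1

/-- The expected reward of a player is affine under mixtures of that player's policy. -/
theorem Policy.IsMixture.value_deviate (hrecall : G.PerfectRecall) (hlam : ∑ k, lam k = 1)
    (hσ : IsMixture lam ν σ) (π : G.Policy) (i : ι) :
    G.value G.baseReward (π.deviate i σ) i =
      ∑ k, lam k * G.value G.baseReward (π.deviate i (ν k)) i := by
  simp only [Policy.value_deviate, Finset.mul_sum]
  rw [Finset.sum_comm]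
  refine Finset.sum_congr rfl fun h hh => ?_
  rw [Finset.sum_comm]
  refine Finset.sum_congr rfl fun a _ => ?_
  have key : σ.seqProb (G.ownPast i h) * (π.deviate i σ).prob h a =
      ∑ k, lam k * ((ν k).seqProb (G.ownPast i h) * (π.deviate i (ν k)).prob h a) := by
    by_cases ht : G.turn h = some i
    · obtain ⟨x, hx, rfl⟩ := turn_eq_some_iff.1 ht
      simp only [prob, hx, deviate_of_owner _ _ rfl, hrecall.ownPast_eq hh hx]
      have h1 := hσ.infoReach_eq hrecall hlam x
      have h2 := hσ x a
      rw [← h1] at h2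
      exact h2
    · simp only [prob_deviate_of_turn_ne _ _ ht]
      rw [hσ.seqProb_eq hrecall hlam i hh, Finset.sum_mul]
      exact Finset.sum_congr rfl fun k _ => by ring
  rw [key, Finset.mul_sum, Finset.sum_mul]
  exact Finset.sum_congr rfl fun k _ => by simp only [baseReward]; ring

end Mixture

/-! ### The dilated Kullback-Leibler divergence -/

theorem sub_le_mul_log_div {p q : ℝ} (hp : 0 ≤ p) (hq : 0 ≤ q) (hpq : q = 0 → p = 0) :
    p - q ≤ p * Real.log (p / q) := by
  rcases hp.eq_or_lt with rfl | hp
  · simpa using hq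
  have hq' : 0 < q := lt_of_le_of_ne hq fun h => hp.ne' (hpq h.symm)
  have h1 : 1 - (p / q)⁻¹ ≤ Real.log (p / q) := Real.one_sub_inv_le_log_of_pos (by positivity)
  calc p - q = p * (1 - (p / q)⁻¹) := by field_simp
    _ ≤ _ := mul_le_mul_of_nonneg_left h1 hp.le

theorem continuousAt_mul_log_div {p q : ℝ} (hq : 0 < q) :
    ContinuousAt (fun z : ℝ × ℝ => z.1 * Real.log (z.1 / z.2)) (p, q) := by
  have h1 : ContinuousAt (fun z : ℝ × ℝ => z.2 * (z.1 / z.2 * Real.log (z.1 / z.2))) (p, q) := by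
    have h2 : ContinuousAt (fun z : ℝ × ℝ => z.1 / z.2) (p, q) :=
      continuousAt_fst.div continuousAt_snd hq.ne'
    exact continuousAt_snd.mul (Real.continuous_mul_log.continuousAt.comp h2)
  refine h1.congr ?_
  filter_upwards [continuousAt_snd.eventually (lt_mem_nhds hq)] with z hz
  have : z.2 ≠ 0 := ne_of_gt hz
  field_simp

/-- The Kullback-Leibler divergence of the action distributions of `π` and `μ` at `x`. -/
noncomputable def Policy.infoKL (π μ : G.Policy) (x : X) : ℝ :=
  ∑ a ∈ G.legal x, π.1 x a * Real.log (π.1 x a / μ.1 x a)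

/-- The divergence of player `i`'s policies in `π` and `μ`: the sum of the divergences at the
information states `x` of `i`, weighted with `w x` and with the probability that `π`'s own
actions lead to `x`. -/
noncomputable def Policy.div (i : ι) (w : X → ℝ) (π μ : G.Policy) : ℝ :=
  ∑ x with G.owner x = i, w x * (π.infoReach x * π.infoKL μ x)

theorem Policy.infoKL_nonneg {π μ : G.Policy} {x : X}
    (h : ∀ a ∈ G.legal x, μ.1 x a = 0 → π.1 x a = 0) : 0 ≤ π.infoKL μ x := by
  calc (0 : ℝ) = ∑ a ∈ G.legal x, (π.1 x a - μ.1 x a) := by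
        rw [Finset.sum_sub_distrib, sum_legal, sum_legal, sub_self]
    _ ≤ _ := Finset.sum_le_sum fun a ha =>
        sub_le_mul_log_div (π.nonneg x a) (μ.nonneg x a) (h a ha)

/-- A bound on the divergence of `π` from `μ` bounds the probabilities of `μ` from below. -/
theorem Policy.mul_exp_le_of_infoKL_le {π μ : G.Policy} {x : X} {C : ℝ}
    (hμ : ∀ a ∈ G.legal x, 0 < μ.1 x a) (hC : π.infoKL μ x ≤ C) {a : A} (ha : a ∈ G.legal x)
    (hπ : 0 < π.1 x a) : π.1 x a * Real.exp (-(C + 1) / π.1 x a) ≤ μ.1 x a := by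
  have h1 : π.1 x a * Real.log (π.1 x a / μ.1 x a) ≤ C + 1 := by
    have h2 : ∑ b ∈ (G.legal x).erase a, (π.1 x b - μ.1 x b) ≤
        ∑ b ∈ (G.legal x).erase a, π.1 x b * Real.log (π.1 x b / μ.1 x b) :=
      Finset.sum_le_sum fun b hb => sub_le_mul_log_div (π.nonneg x b) (μ.nonneg x b)
        fun h => absurd h (hμ b (Finset.mem_of_mem_erase hb)).ne'
    have h3 := Finset.add_sum_erase _ (fun b => π.1 x b * Real.log (π.1 x b / μ.1 x b)) ha
    have h4 := Finset.add_sum_erase _ (fun b => π.1 x b - μ.1 x b) ha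
    have h40 : ∑ b ∈ G.legal x, (π.1 x b - μ.1 x b) = 0 := by
      rw [Finset.sum_sub_distrib, sum_legal, sum_legal, sub_self]
    have h5 : π.1 x a ≤ 1 := by
      rw [← π.sum_legal x]
      exact Finset.single_le_sum (fun b _ => π.nonneg x b) ha
    have h6 := hμ a ha
    simp only [infoKL] at hC
    linarith
  have h2 : Real.log (π.1 x a / μ.1 x a) ≤ (C + 1) / π.1 x a := by
    rw [le_div_iff₀ hπ]
    linarith
  have h3 : π.1 x a / μ.1 x a ≤ Real.exp ((C + 1) / π.1 x a) := by
    rw [← Real.log_le_iff_le_exp (div_pos hπ (hμ a ha))]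
    exact h2
  rw [div_le_iff₀ (hμ a ha)] at h3
  rw [neg_div, Real.exp_neg, ← div_eq_mul_inv, div_le_iff₀ (Real.exp_pos _)]
  linarith

theorem Policy.Interior.infoKL_nonneg {μ : G.Policy} (hμ : μ.Interior) (π : G.Policy) (x : X) :
    0 ≤ π.infoKL μ x :=
  Policy.infoKL_nonneg fun a ha h => absurd h (hμ x a ha).ne'

theorem Policy.Interior.div_term_nonneg {μ : G.Policy} (hμ : μ.Interior) {w : X → ℝ}
    (hw : ∀ x, 0 ≤ w x) (π : G.Policy) (x : X) :
    0 ≤ w x * (π.infoReach x * π.infoKL μ x) :=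
  mul_nonneg (hw x) (mul_nonneg (π.infoReach_nonneg x) (hμ.infoKL_nonneg π x))

theorem Policy.Interior.div_nonneg {μ : G.Policy} (hμ : μ.Interior) {w : X → ℝ}
    (hw : ∀ x, 0 ≤ w x) (π : G.Policy) (i : ι) : 0 ≤ π.div i w μ :=
  Finset.sum_nonneg fun x _ => hμ.div_term_nonneg hw π x

theorem Policy.div_congr {π σ : G.Policy} {i : ι} (h : ∀ x, G.owner x = i → π.1 x = σ.1 x)
    (w : X → ℝ) (μ : G.Policy) : Policy.div i w π μ = Policy.div i w σ μ := by
  refine Finset.sum_congr rfl fun x hx => ?_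
  have hx' := (Finset.mem_filter.1 hx).2
  rw [infoReach_congr fun y hy => h y (hy.trans hx'), infoKL, infoKL, h x hx']

theorem Policy.div_self (i : ι) (w : X → ℝ) (π : G.Policy) : π.div i w π = 0 := by
  refine Finset.sum_eq_zero fun x _ => ?_
  have : π.infoKL π x = 0 := Finset.sum_eq_zero fun a _ => by
    by_cases h : π.1 x a = 0
    · simp [h]
    · simp [_root_.div_self h]
  rw [this, mul_zero, mul_zero]

/-- Policies at divergence zero agree: descending the tree, the information states reached by
`μ` are reached by `π`, too. -/
theorem Policy.Interior.eq_of_div_eq_zero (hrecall : G.PerfectRecall) {π μ : G.Policy}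
    (hμ : μ.Interior) {w : X → ℝ} (hw : ∀ x, 0 < w x) (h : ∀ i, π.div i w μ = 0) : π = μ := by
  have key : ∀ x, 0 < π.infoReach x → π.1 x = μ.1 x := by
    intro x hx
    have h1 := (Finset.sum_eq_zero_iff_of_nonneg
      fun y _ => hμ.div_term_nonneg (fun x => (hw x).le) π y).1 (h (G.owner x)) x (by simp)
    have h2 : π.infoKL μ x = 0 := by
      simpa [(hw x).ne', hx.ne'] using h1
    have hnn : ∀ a ∈ G.legal x,
        0 ≤ π.1 x a * Real.log (π.1 x a / μ.1 x a) - (π.1 x a - μ.1 x a) := fun a ha =>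
      sub_nonneg.2 (sub_le_mul_log_div (π.nonneg x a) (μ.nonneg x a)
        fun h => absurd h (hμ x a ha).ne')
    have h3 : ∑ a ∈ G.legal x,
        (π.1 x a * Real.log (π.1 x a / μ.1 x a) - (π.1 x a - μ.1 x a)) = 0 := by
      rw [Finset.sum_sub_distrib, Finset.sum_sub_distrib, sum_legal, sum_legal, sub_self, sub_zero]
      exact h2
    funext a
    by_cases ha : a ∈ G.legal x
    · have h4 := (Finset.sum_eq_zero_iff_of_nonneg hnn).1 h3 a ha
      by_contra hne
      have hq := hμ x a ha
      rcases (π.nonneg x a).eq_or_lt with h0 | hp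
      · rw [← h0] at h4
        simp at h4
        exact hq.ne' h4
      · have h5 : Real.log (μ.1 x a / π.1 x a) < μ.1 x a / π.1 x a - 1 :=
          Real.log_lt_sub_one_of_pos (by positivity) fun h => hne (by
            rw [div_eq_one_iff_eq hp.ne'] at h; exact h.symm)
        have h6 : Real.log (π.1 x a / μ.1 x a) = - Real.log (μ.1 x a / π.1 x a) := by
          rw [← Real.log_inv, inv_div]
        have h7 := mul_lt_mul_of_pos_left h5 hp
        rw [h6] at h4
        have h8 : π.1 x a * (μ.1 x a / π.1 x a - 1) = μ.1 x a - π.1 x a := by field_simp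
        linarith
    · rw [π.eq_zero ha, μ.eq_zero ha]
  have hreach : ∀ i, ∀ h ∈ G.hist, 0 < π.seqProb (G.ownPast i h) := by
    intro i h hh
    induction h with
    | nil => simp [ownPast]
    | cons a h ih =>
      have hh' := G.prefix_mem a h hh
      by_cases ht : G.turn h = some i
      · obtain ⟨x, hx, rfl⟩ := turn_eq_some_iff.1 ht
        have h1 := ih hh'
        rw [ownPast_cons_of_owner hx rfl, seqProb_cons]
        rw [key x (by rw [infoReach, ← hrecall.ownPast_eq hh' hx]; exact h1)]
        exact mul_pos (hμ x a ((G.mem_legal_iff h hh' x hx a).2 hh)) h1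
      · rw [ownPast_cons_of_turn_ne ht]
        exact ih hh'
  exact Subtype.ext (funext fun x => key x (hreach _ _ (G.info_surj x).choose_spec.1))

section Mixture

variable {κ : Type*} [Fintype κ] {lam : κ → ℝ} {ν : κ → G.Policy} {σ : G.Policy}

theorem Policy.IsMixture.weight_eq_zero (hlam : ∀ k, 0 ≤ lam k) (hσ : IsMixture lam ν σ) {x : X}
    {a : A} (ha : σ.1 x a = 0) (k : κ) : lam k * ((ν k).infoReach x * (ν k).1 x a) = 0 := by
  have h := hσ x a
  rw [ha, mul_zero] at h
  exact (Finset.sum_eq_zero_iff_of_nonneg fun k _ => mul_nonneg (hlam k)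
    (mul_nonneg ((ν k).infoReach_nonneg x) ((ν k).nonneg x a))).1 h.symm k (Finset.mem_univ _)

/-- The compensation identity: the mean divergence from `μ` exceeds the divergence of the mixture
by the mean divergence from the mixture. -/
theorem Policy.IsMixture.sum_div (hrecall : G.PerfectRecall) (hlam : lam ∈ stdSimplex ℝ κ)
    (hσ : IsMixture lam ν σ) {μ : G.Policy} (hμ : μ.Interior) (i : ι) (w : X → ℝ) :
    ∑ k, lam k * (ν k).div i w μ = σ.div i w μ + ∑ k, lam k * (ν k).div i w σ := by
  simp only [div, Finset.mul_sum]
  rw [Finset.sum_comm, Finset.sum_comm (s := Finset.univ), ← Finset.sum_add_distrib]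
  refine Finset.sum_congr rfl fun x _ => ?_
  have key : ∑ k, lam k * ((ν k).infoReach x * (ν k).infoKL μ x) =
      σ.infoReach x * σ.infoKL μ x +
        ∑ k, lam k * ((ν k).infoReach x * (ν k).infoKL σ x) := by
    simp only [infoKL, Finset.mul_sum]
    rw [Finset.sum_comm, Finset.sum_comm (s := Finset.univ), ← Finset.sum_add_distrib]
    refine Finset.sum_congr rfl fun a ha => ?_
    have h1 : σ.infoReach x * (σ.1 x a * Real.log (σ.1 x a / μ.1 x a)) =
        ∑ k, lam k * ((ν k).infoReach x * (ν k).1 x a) * Real.log (σ.1 x a / μ.1 x a) := by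
      rw [← Finset.sum_mul, ← hσ x a, ← hσ.infoReach_eq hrecall hlam.2, mul_assoc]
    rw [h1, ← Finset.sum_add_distrib]
    refine Finset.sum_congr rfl fun k _ => ?_
    have h2 : lam k * ((ν k).infoReach x * ((ν k).1 x a * Real.log ((ν k).1 x a / μ.1 x a))) =
        lam k * ((ν k).infoReach x * (ν k).1 x a) * Real.log ((ν k).1 x a / μ.1 x a) := by ring
    have h3 : lam k * ((ν k).infoReach x * ((ν k).1 x a * Real.log ((ν k).1 x a / σ.1 x a))) =
        lam k * ((ν k).infoReach x * (ν k).1 x a) * Real.log ((ν k).1 x a / σ.1 x a) := by ring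
    rw [h2, h3]
    by_cases h0 : lam k * ((ν k).infoReach x * (ν k).1 x a) = 0
    · simp [h0]
    · have hν : (ν k).1 x a ≠ 0 := right_ne_zero_of_mul (right_ne_zero_of_mul h0)
      have hs : σ.1 x a ≠ 0 := fun h => h0 (hσ.weight_eq_zero hlam.1 h k)
      have hm := (hμ x a ha).ne'
      rw [← mul_add, Real.log_div hν hm, Real.log_div hs hm, Real.log_div hν hs]
      ring
  have e1 : ∀ τ : G.Policy, ∑ k, lam k * (w x * ((ν k).infoReach x * (ν k).infoKL τ x)) =
      w x * ∑ k, lam k * ((ν k).infoReach x * (ν k).infoKL τ x) := fun τ => by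
    rw [Finset.mul_sum]
    exact Finset.sum_congr rfl fun k _ => by ring
  rw [e1, e1, key, mul_add]

theorem Policy.IsMixture.mul_div_nonneg (hlam : ∀ k, 0 ≤ lam k) (hσ : IsMixture lam ν σ)
    {w : X → ℝ} (hw : ∀ x, 0 ≤ w x) (i : ι) (k : κ) : 0 ≤ lam k * (ν k).div i w σ := by
  unfold div
  rw [Finset.mul_sum]
  refine Finset.sum_nonneg fun x _ => ?_
  by_cases h0 : lam k * (ν k).infoReach x = 0
  · rw [show lam k * (w x * ((ν k).infoReach x * (ν k).infoKL σ x)) =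
      lam k * (ν k).infoReach x * (w x * (ν k).infoKL σ x) by ring, h0, zero_mul]
  · refine mul_nonneg (hlam k) (mul_nonneg (hw x) (mul_nonneg ((ν k).infoReach_nonneg x)
      (infoKL_nonneg fun a _ ha => ?_)))
    have := hσ.weight_eq_zero hlam ha k
    rw [← mul_assoc] at this
    exact (mul_eq_zero.1 this).resolve_left h0

/-- The divergence from an interior policy is convex under mixtures. -/
theorem Policy.IsMixture.div_le (hrecall : G.PerfectRecall) (hlam : lam ∈ stdSimplex ℝ κ)
    (hσ : IsMixture lam ν σ) {μ : G.Policy} (hμ : μ.Interior) (i : ι) {w : X → ℝ}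
    (hw : ∀ x, 0 ≤ w x) : σ.div i w μ ≤ ∑ k, lam k * (ν k).div i w μ := by
  rw [hσ.sum_div hrecall hlam hμ]
  exact le_add_of_nonneg_right
    (Finset.sum_nonneg fun k _ => hσ.mul_div_nonneg hlam.1 hw i k)

end Mixture

/-! ### Continuity -/

theorem continuous_eval (x : X) (a : A) : Continuous fun π : G.Policy => π.1 x a :=
  (continuous_apply a).comp ((continuous_apply x).comp continuous_subtype_val)

theorem Policy.continuous_seqProb (l : List (X × A)) :
    Continuous fun π : G.Policy => π.seqProb l := by
  induction l with
  | nil => simpa using continuous_const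
  | cons p l ih =>
    simp only [seqProb, List.map_cons, List.prod_cons]
    exact (continuous_eval p.1 p.2).mul ih

theorem Policy.continuous_prob (h : List A) (a : A) :
    Continuous fun π : G.Policy => π.prob h a := by
  unfold prob
  cases G.info h with
  | none => exact continuous_const
  | some x => exact continuous_eval x a

theorem Policy.continuous_reach (h : List A) : Continuous fun π : G.Policy => π.reach h := by
  induction h with
  | nil => exact continuous_const
  | cons a h ih => exact ih.mul (continuous_prob h a)

theorem continuous_value (i : ι) : Continuous fun π : G.Policy => G.value G.baseReward π i :=
  continuous_finsetSum _ fun h _ => (Policy.continuous_reach h).mul <|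
    continuous_finsetSum _ fun a _ => (Policy.continuous_prob h a).mul continuous_const

theorem Policy.continuous_deviate (i : ι) :
    Continuous fun p : G.Policy × G.Policy => p.1.deviate i p.2 := by
  refine Continuous.subtype_mk (continuous_pi fun x => ?_) _
  by_cases hx : G.owner x = i
  · simp only [hx, if_true]
    exact (continuous_apply x).comp (continuous_subtype_val.comp continuous_snd)
  · simp only [hx, if_false]
    exact (continuous_apply x).comp (continuous_subtype_val.comp continuous_fst)

theorem Policy.Interior.continuousAt_div {μ : G.Policy} (hμ : μ.Interior) (π : G.Policy) (i : ι)
    (w : X → ℝ) :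
    ContinuousAt (fun p : G.Policy × G.Policy => p.1.div i w p.2) (π, μ) := by
  refine tendsto_finsetSum _ fun x _ => Tendsto.const_mul _ (Tendsto.mul ?_ ?_)
  · exact ((continuous_seqProb _).comp continuous_fst).continuousAt
  · refine tendsto_finsetSum _ fun a ha => ?_
    have h1 : Tendsto (fun p : G.Policy × G.Policy => (p.1.1 x a, p.2.1 x a)) (𝓝 (π, μ))
        (𝓝 (π.1 x a, μ.1 x a)) :=
      (((continuous_eval x a).comp continuous_fst).prodMk
        ((continuous_eval x a).comp continuous_snd)).continuousAt
    exact (continuousAt_mul_log_div (hμ x a ha)).tendsto.comp h1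

theorem Policy.Interior.tendsto_div {β : Type*} {l : Filter β} {f g : β → G.Policy}
    {π μ : G.Policy} (hμ : μ.Interior) (hf : Tendsto f l (𝓝 π)) (hg : Tendsto g l (𝓝 μ)) (i : ι)
    (w : X → ℝ) : Tendsto (fun b => (f b).div i w (g b)) l (𝓝 (π.div i w μ)) := by
  have h : Tendsto (fun p : G.Policy × G.Policy => p.1.div i w p.2) (𝓝 (π, μ))
    (𝓝 (π.div i w μ)) := hμ.continuousAt_div π i w
  have h2 : Tendsto (fun b => (f b, g b)) l (𝓝 (π, μ)) := hf.prodMk_nhds hg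
  exact Tendsto.comp (f := fun b => (f b, g b)) h h2

instance : CompactSpace G.Policy := by
  refine isCompact_iff_compactSpace.1 ?_
  have h1 : IsCompact (Set.univ.pi fun _ : X => stdSimplex ℝ A) :=
    isCompact_univ_pi fun _ => isCompact_stdSimplex ℝ A
  refine h1.of_isClosed_subset ?_ fun π hπ x _ => (hπ x).1
  have h2 : {π : X → A → ℝ | ∀ x, π x ∈ stdSimplex ℝ A ∧ ∀ a ∉ G.legal x, π x a = 0} =
      ⋂ x, ({π | π x ∈ stdSimplex ℝ A} ∩ ⋂ a, ⋂ (_ : a ∉ G.legal x), {π | π x a = 0}) := by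
    ext π
    simp
  change IsClosed {π : X → A → ℝ | ∀ x, π x ∈ stdSimplex ℝ A ∧ ∀ a ∉ G.legal x, π x a = 0}
  rw [h2]
  refine isClosed_iInter fun x => IsClosed.inter ?_ (isClosed_iInter fun a =>
    isClosed_iInter fun _ => ?_)
  · exact (isClosed_stdSimplex ℝ A).preimage (continuous_apply x)
  · exact isClosed_eq ((continuous_apply a).comp (continuous_apply x)) continuous_const

/-! ### Regularized best responses -/

/-- Player `i`'s part of `π` is optimal against the other players' part of `π` for the expected
reward minus `η` times the divergence from `μ`. -/
def Policy.IsRegBestResponse (η : ℝ) (w : X → ℝ) (μ π : G.Policy) (i : ι) : Prop :=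
  ∀ ν : G.Policy, G.value G.baseReward (π.deviate i ν) i - η * ν.div i w μ ≤
    G.value G.baseReward π i - η * π.div i w μ

theorem segment_mem_stdSimplex {t : ℝ} (h0 : 0 < t) (h1 : t < 1) :
    ![1 - t, t] ∈ stdSimplex ℝ (Fin 2) := by
  refine ⟨fun k => ?_, by simp⟩
  fin_cases k
  · simpa using h1.le
  · simpa using h0.le

/-- Comparing `π` with a mixture `σ` of `π` and `ν` on the segment between them, the compensation
identity turns optimality into an inequality that no longer depends on the weight of `ν`, except
through `σ`. -/
theorem Policy.IsRegBestResponse.value_sub_le_of_isMixture (hrecall : G.PerfectRecall) {η : ℝ}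
    (hη : 0 ≤ η) {w : X → ℝ} (hw : ∀ x, 0 ≤ w x) {μ π ν σ : G.Policy} (hμ : μ.Interior) {i : ι}
    (hπ : IsRegBestResponse η w μ π i) {t : ℝ} (h0 : 0 < t) (h1 : t < 1)
    (hσ : IsMixture ![1 - t, t] ![π, ν] σ) :
    G.value G.baseReward (π.deviate i ν) i - G.value G.baseReward π i ≤
      η * (ν.div i w μ - π.div i w μ - ν.div i w σ) := by
  have hlam := segment_mem_stdSimplex h0 h1
  have e1 := hσ.value_deviate hrecall hlam.2 π i
  have e2 := hσ.sum_div hrecall hlam hμ i w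
  have e3 := hσ.mul_div_nonneg hlam.1 hw i 0
  simp only [Fin.sum_univ_two, Matrix.cons_val_zero, Matrix.cons_val_one, deviate_self] at e1 e2 e3
  have e4 := hπ σ
  rw [e1, eq_sub_of_add_eq e2.symm] at e4
  have e5 := mul_nonneg hη e3
  refine le_of_mul_le_mul_left ?_ h0
  linarith

theorem Policy.IsMixture.interior (hrecall : G.PerfectRecall) {κ : Type*} [Fintype κ]
    {lam : κ → ℝ} {ν : κ → G.Policy} {σ : G.Policy} (hlam : ∀ k, 0 ≤ lam k)
    (hσ : IsMixture lam ν σ) {k : κ} (hk : 0 < lam k) (hν : (ν k).Interior) : σ.Interior := by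
  intro x a ha
  refine lt_of_le_of_ne (σ.nonneg x a) fun h => ?_
  have h1 := hσ.weight_eq_zero hlam h.symm k
  have h2 := hν.infoReach_pos hrecall x
  have h3 := hν x a ha
  exact (by positivity : 0 < lam k * ((ν k).infoReach x * (ν k).1 x a)).ne' h1

/-- Mixtures of `π` and `ν` in which the weight of `ν` tends to zero; they converge to `π` wherever
`π` is determined by its realization weights. -/
theorem Policy.exists_isMixture_seq (π ν : G.Policy) :
    ∃ (t : ℕ → ℝ) (σ : ℕ → G.Policy), (∀ m, 0 < t m ∧ t m < 1) ∧
      (∀ m, IsMixture ![1 - t m, t m] ![π, ν] (σ m)) ∧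
      ∀ x, 0 < π.infoReach x → ∀ a, Tendsto (fun m => (σ m).1 x a) atTop (𝓝 (π.1 x a)) := by
  obtain ⟨t, ht, hlim⟩ : ∃ t : ℕ → ℝ, (∀ m, 0 < t m ∧ t m < 1) ∧ Tendsto t atTop (𝓝 0) := by
    refine ⟨fun m => 1 / ((m + 1 : ℕ) + 1), fun m => ⟨by positivity, ?_⟩,
      (tendsto_one_div_add_atTop_nhds_zero_nat (𝕜 := ℝ)).comp (tendsto_add_atTop_nat 1)⟩
    rw [div_lt_one (by positivity)]
    push_cast
    linarith [(Nat.cast_nonneg m : (0 : ℝ) ≤ m)]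
  choose σ hσ using fun m => exists_isMixture
    (segment_mem_stdSimplex (ht m).1 (ht m).2) ![π, ν]
  refine ⟨t, σ, ht, hσ, fun x hx a => ?_⟩
  have hpos : ∀ m, 0 < (1 - t m) * π.infoReach x + t m * ν.infoReach x := fun m =>
    add_pos_of_pos_of_nonneg (mul_pos (sub_pos.2 (ht m).2) hx)
      (mul_nonneg (ht m).1.le (ν.infoReach_nonneg x))
  have heq : ∀ m, (σ m).1 x a = ((1 - t m) * (π.infoReach x * π.1 x a) +
      t m * (ν.infoReach x * ν.1 x a)) / ((1 - t m) * π.infoReach x + t m * ν.infoReach x) := by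
    intro m
    have h := hσ m x a
    simp only [Fin.sum_univ_two, Matrix.cons_val_zero, Matrix.cons_val_one] at h
    rw [eq_div_iff (hpos m).ne', mul_comm]
    exact h
  have h1 : Tendsto (fun m => 1 - t m) atTop (𝓝 1) := by simpa using hlim.const_sub 1
  have h2 := ((h1.mul_const (π.infoReach x * π.1 x a)).add
    (hlim.mul_const (ν.infoReach x * ν.1 x a))).div
    ((h1.mul_const (π.infoReach x)).add (hlim.mul_const (ν.infoReach x))) (by simpa using hx.ne')
  simp only [one_mul, zero_mul, add_zero, mul_div_cancel_left₀ _ hx.ne'] at h2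
  exact h2.congr fun m => (heq m).symm

theorem Policy.IsRegBestResponse.pos (hrecall : G.PerfectRecall) {η : ℝ}
    (hη : 0 < η) {w : X → ℝ} (hw : ∀ x, 0 ≤ w x) {μ π : G.Policy} (hμ : μ.Interior) {i : ι}
    (hπ : IsRegBestResponse η w μ π i) {x : X} (hi : G.owner x = i) (hwx : 0 < w x)
    (hx : 0 < π.infoReach x) {a : A} (ha : a ∈ G.legal x) : 0 < π.1 x a := by
  obtain ⟨t, σ, ht, hσ, hlim⟩ := exists_isMixture_seq π μ
  have hR := hμ.infoReach_pos hrecall x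
  obtain ⟨C, hC⟩ : ∃ C, ∀ m, μ.infoKL (σ m) x ≤ C := by
    refine ⟨((G.value G.baseReward π i - G.value G.baseReward (π.deviate i μ) i) / η -
      π.div i w μ) / (w x * μ.infoReach x), fun m => ?_⟩
    have hint : (σ m).Interior := (hσ m).interior hrecall
      (segment_mem_stdSimplex (ht m).1 (ht m).2).1 (k := 1) (by simpa using (ht m).1)
      (by simpa using hμ)
    have h1 := hπ.value_sub_le_of_isMixture hrecall hη.le hw hμ (ht m).1 (ht m).2 (hσ m)
    rw [div_self] at h1
    have h2 : w x * (μ.infoReach x * μ.infoKL (σ m) x) ≤ μ.div i w (σ m) :=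
      Finset.single_le_sum (f := fun x => w x * (μ.infoReach x * μ.infoKL (σ m) x))
        (fun y _ => hint.div_term_nonneg hw μ y) (by simp [hi])
    rw [le_div_iff₀ (by positivity), le_sub_iff_add_le, le_div_iff₀ hη]
    nlinarith
  have h1 : ∀ m, μ.1 x a * Real.exp (-(C + 1) / μ.1 x a) ≤ (σ m).1 x a := fun m =>
    mul_exp_le_of_infoKL_le (fun b hb => (hσ m).interior hrecall
      (segment_mem_stdSimplex (ht m).1 (ht m).2).1 (k := 1) (by simpa using (ht m).1)
      (by simpa using hμ) x b hb) (hC m) ha (hμ x a ha)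
  exact lt_of_lt_of_le (mul_pos (hμ x a ha) (Real.exp_pos _))
    (ge_of_tendsto' (hlim x hx a) h1)

theorem tendsto_policy {β : Type*} {l : Filter β} {f : β → G.Policy} {π : G.Policy} :
    Tendsto f l (𝓝 π) ↔ ∀ x a, Tendsto (fun b => (f b).1 x a) l (𝓝 (π.1 x a)) := by
  rw [tendsto_subtype_rng, tendsto_pi_nhds]
  exact forall_congr' fun x => tendsto_pi_nhds

/-- The variational inequality of an interior regularized best response. -/
theorem Policy.IsRegBestResponse.value_sub_le (hrecall : G.PerfectRecall) {η : ℝ}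
    (hη : 0 ≤ η) {w : X → ℝ} (hw : ∀ x, 0 ≤ w x) {μ π : G.Policy} (hμ : μ.Interior) {i : ι}
    (hπ : IsRegBestResponse η w μ π i) (hint : π.Interior) (ν : G.Policy) :
    G.value G.baseReward (π.deviate i ν) i - G.value G.baseReward π i ≤
      η * (ν.div i w μ - π.div i w μ - ν.div i w π) := by
  obtain ⟨t, σ, ht, hσ, hlim⟩ := exists_isMixture_seq π ν
  have h1 : Tendsto σ atTop (𝓝 π) :=
    tendsto_policy.2 fun x a => hlim x (hint.infoReach_pos hrecall x) a
  have h2 : Tendsto (fun m => ν.div i w (σ m)) atTop (𝓝 (ν.div i w π)) :=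
    hint.tendsto_div tendsto_const_nhds h1 i w
  have h3 : Tendsto (fun m => η * (ν.div i w μ - π.div i w μ - ν.div i w (σ m))) atTop
      (𝓝 (η * (ν.div i w μ - π.div i w μ - ν.div i w π))) := (h2.const_sub _).const_mul η
  exact ge_of_tendsto' h3 fun m =>
    hπ.value_sub_le_of_isMixture hrecall hη hw hμ (ht m).1 (ht m).2 (hσ m)

/-! ### Existence of regularized equilibria -/

/-- A matrix game in which no pure strategy profile and its mirror image have a negative total
payoff has a mixed strategy with nonnegative payoff against every pure strategy. -/
theorem exists_stdSimplex_forall_sum_nonneg {n : Type*} [Fintype n] [Nonempty n]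
    (M : n → n → ℝ) (hM : ∀ j k, 0 ≤ M j k + M k j) :
    ∃ lam ∈ stdSimplex ℝ n, ∀ j, 0 ≤ ∑ k, lam k * M j k := by
  classical
  by_contra! hcon
  let T : (n → ℝ) →ₗ[ℝ] (n → ℝ) := (Matrix.of M).mulVecLin
  have hT : ∀ p j, T p j = ∑ k, p k * M j k := fun p j => by
    simp [T, Matrix.mulVec, dotProduct, mul_comm]
  have hcomp : IsCompact (T '' stdSimplex ℝ n) :=
    (isCompact_stdSimplex ℝ n).image (LinearMap.continuous_of_finiteDimensional T)
  have hdisj : Disjoint (T '' stdSimplex ℝ n) (Set.Ici 0) := by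
    rw [Set.disjoint_left]
    rintro _ ⟨p, hp, rfl⟩ hq
    obtain ⟨j, hj⟩ := hcon p hp
    have := hq j
    rw [hT] at this
    exact absurd hj (not_lt.2 this)
  obtain ⟨f, u, v, hu, huv, hv⟩ := geometric_hahn_banach_compact_closed
    ((convex_stdSimplex ℝ n).linear_image T) hcomp (convex_Ici 0) isClosed_Ici hdisj
  have hv0 : v < 0 := by simpa using hv 0 (Set.mem_Ici.2 le_rfl)
  have hf : ∀ p, f p = ∑ j, p j * f (Pi.single j 1) := fun p => by
    conv_lhs => rw [pi_eq_sum_univ' p]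
    simp [map_sum, map_smul]
  set g : n → ℝ := fun j => f (Pi.single j 1) with hg
  have hg0 : ∀ j, 0 ≤ g j := by
    intro j
    by_contra! hneg
    have h1 := hv ((v / g j) • Pi.single j 1) (Set.mem_Ici.2
      (smul_nonneg (div_nonneg_of_nonpos hv0.le hneg.le) (Pi.single_nonneg.2 zero_le_one)))
    rw [map_smul, smul_eq_mul, div_mul_cancel₀ _ hneg.ne] at h1
    exact lt_irrefl _ h1
  have hneg : ∀ p ∈ stdSimplex ℝ n, ∑ j, T p j * g j < 0 := fun p hp => by
    rw [← hf]
    exact ((hu _ ⟨p, hp, rfl⟩).trans huv).trans hv0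
  have hs : 0 < ∑ j, g j := by
    refine lt_of_le_of_ne (Finset.sum_nonneg fun j _ => hg0 j) fun h => ?_
    have h1 := (Finset.sum_eq_zero_iff_of_nonneg fun j _ => hg0 j).1 h.symm
    obtain ⟨j₀⟩ := ‹Nonempty n›
    have h2 := hneg _ (single_mem_stdSimplex ℝ j₀)
    rw [Finset.sum_eq_zero fun j hj => by rw [h1 j hj, mul_zero]] at h2
    exact lt_irrefl _ h2
  -- the separating functional itself, normalized, violates the separation
  have h1 := hneg (fun j => g j / ∑ j, g j)
    ⟨fun j => div_nonneg (hg0 j) hs.le, by rw [← Finset.sum_div, div_self hs.ne']⟩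
  refine absurd h1 (not_lt.2 ?_)
  have h2 : ∑ j, T (fun j => g j / ∑ j, g j) j * g j =
      (∑ j, ∑ k, g j * g k * M j k) / ∑ j, g j := by
    simp only [hT, Finset.sum_mul, Finset.sum_div]
    exact Finset.sum_congr rfl fun j _ => Finset.sum_congr rfl fun k _ => by ring
  rw [h2]
  refine div_nonneg ?_ hs.le
  have h3 : ∑ j, ∑ k, g j * g k * M j k = ∑ j, ∑ k, g j * g k * M k j := by
    rw [Finset.sum_comm]
    exact Finset.sum_congr rfl fun j _ => Finset.sum_congr rfl fun k _ => by ring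
  have h4 : 0 ≤ ∑ j, ∑ k, g j * g k * (M j k + M k j) := Finset.sum_nonneg fun j _ =>
    Finset.sum_nonneg fun k _ => mul_nonneg (mul_nonneg (hg0 j) (hg0 k)) (hM j k)
  simp only [mul_add, Finset.sum_add_distrib] at h4
  linarith

theorem Monotone.sum_omega_le (hmono : G.Monotone) (π μ : G.Policy) :
    ∑ i, G.omega i π μ ≤ 0 := by
  by_cases h : π = μ
  · subst h
    simp [omega, Policy.deviate_self]
  · exact hmono π μ h

/-- The total gain of the players in the regularized game when each of them, separately, moves from
`ν` to `π`. -/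
noncomputable def regGain (η : ℝ) (w : X → ℝ) (μ ν π : G.Policy) : ℝ :=
  ∑ i, ((G.value G.baseReward (ν.deviate i π) i - η * π.div i w μ) -
    (G.value G.baseReward ν i - η * ν.div i w μ))

/-- A monotone game has a regularized equilibrium: a policy `π` with `0 ≤ regGain η w μ ν π` for all
`ν` is one, as the policies `ν = π.deviate i τ` show. For finitely many `ν` such a `π` exists as a
mixture of them, because `regGain` is concave in `π` and, by monotonicity, its values at `(ν, π)`
and `(π, ν)` have a nonnegative sum; compactness does the rest. -/
theorem Monotone.exists_isRegBestResponse (hrecall : G.PerfectRecall) (hmono : G.Monotone)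
    {η : ℝ} (hη : 0 ≤ η) {w : X → ℝ} (hw : ∀ x, 0 ≤ w x) {μ : G.Policy} (hμ : μ.Interior) :
    ∃ π : G.Policy, ∀ i, Policy.IsRegBestResponse η w μ π i := by
  have hcont : ∀ ν : G.Policy, Continuous fun π => regGain η w μ ν π := fun ν => by
    refine continuous_finsetSum _ fun i _ => Continuous.sub (Continuous.sub ?_ ?_)
      continuous_const
    · exact (continuous_value i).comp
        ((Policy.continuous_deviate i).comp (continuous_const.prodMk continuous_id))
    · refine continuous_const.mul (continuous_iff_continuousAt.2 fun π => ?_)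
      exact hμ.tendsto_div tendsto_id tendsto_const_nhds i w
  have hfin : ∀ u : Finset G.Policy, (⋂ ν ∈ u, {π | 0 ≤ regGain η w μ ν π}).Nonempty := by
    intro u
    rcases u.eq_empty_or_nonempty with rfl | hu
    · exact ⟨μ, by simp⟩
    have : Nonempty u := hu.to_subtype
    obtain ⟨lam, hlam, hpos⟩ := exists_stdSimplex_forall_sum_nonneg
      (fun ν π : u => regGain η w μ ν.1 π.1) (fun ν π => by
        have h := hmono.sum_omega_le ν.1 π.1
        have h1 : regGain η w μ ν.1 π.1 + regGain η w μ π.1 ν.1 = - ∑ i, G.omega i ν.1 π.1 := by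
          simp only [regGain, omega]
          rw [← Finset.sum_add_distrib, ← Finset.sum_neg_distrib]
          exact Finset.sum_congr rfl fun i _ => by ring
        linarith)
    obtain ⟨σ, hσ⟩ := Policy.exists_isMixture hlam fun ν : u => ν.1
    refine ⟨σ, Set.mem_iInter₂.2 fun ν hν => (hpos ⟨ν, hν⟩).trans ?_⟩
    simp only [regGain, Finset.mul_sum]
    rw [Finset.sum_comm]
    refine Finset.sum_le_sum fun i _ => ?_
    have h1 := hσ.value_deviate hrecall hlam.2 ν i
    have h2 := mul_le_mul_of_nonneg_left (hσ.div_le hrecall hlam hμ i hw) hη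
    have h3 : ∑ k : u, lam k * ((G.value G.baseReward (ν.deviate i k.1) i - η * k.1.div i w μ) -
        (G.value G.baseReward ν i - η * ν.div i w μ)) =
        ∑ k : u, lam k * G.value G.baseReward (ν.deviate i k.1) i -
          η * ∑ k : u, lam k * k.1.div i w μ -
          (∑ k, lam k) * (G.value G.baseReward ν i - η * ν.div i w μ) := by
      rw [Finset.mul_sum, Finset.sum_mul, ← Finset.sum_sub_distrib, ← Finset.sum_sub_distrib]
      exact Finset.sum_congr rfl fun k _ => by ring
    rw [h3, hlam.2, one_mul, h1]
    linarith
  obtain ⟨π, hπ⟩ := CompactSpace.iInter_nonempty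
    (fun ν : G.Policy => isClosed_le continuous_const (hcont ν)) hfin
  refine ⟨π, fun i ν => ?_⟩
  have h := Set.mem_iInter.1 hπ (π.deviate i ν)
  have hsum : regGain η w μ (π.deviate i ν) π =
      (G.value G.baseReward π i - η * π.div i w μ) -
        (G.value G.baseReward (π.deviate i ν) i - η * ν.div i w μ) := by
    unfold regGain
    rw [Finset.sum_eq_single i]
    · rw [Policy.deviate_deviate_self,
        Policy.div_congr (fun x hx => Policy.deviate_of_owner π ν hx)]
    · intro j _ hj
      have hjx : ∀ x, G.owner x = j → (π.deviate i ν).1 x = π.1 x := fun x hx =>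
        Policy.deviate_of_owner_ne _ _ (hx ▸ hj)
      rw [Policy.deviate_eq_left fun x hx => (hjx x hx).symm, Policy.div_congr hjx, sub_self]
    · simp
  have h' : 0 ≤ regGain η w μ (π.deviate i ν) π := h
  rw [hsum] at h'
  exact sub_nonneg.1 h'

/-! ### The transformed game -/

open scoped Classical in
variable (G) in
/-- The number of histories in an information state. -/
noncomputable def infoCount (x : X) : ℝ := ({h ∈ G.hist | G.info h = some x}).card

open scoped Classical in
/-- The number of histories in an information state that the opponents of `i` and chance do not
exclude. These are the histories at which the transformed reward is regularized; the others are
lost to `η / 0 = 0`. -/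
noncomputable def Policy.openCount (π : G.Policy) (i : ι) (x : X) : ℝ :=
  ({h ∈ G.hist | G.info h = some x ∧ π.reachOpp i h ≠ 0}).card

variable (G) in
theorem infoCount_pos (x : X) : 0 < G.infoCount x := by
  classical
  obtain ⟨h, hh, hx⟩ := G.info_surj x
  exact Nat.cast_pos.2 (Finset.card_pos.2 ⟨h, by simp [hh, hx]⟩)

theorem Policy.openCount_nonneg (π : G.Policy) (i : ι) (x : X) : 0 ≤ π.openCount i x :=
  Nat.cast_nonneg _

theorem Policy.openCount_pos {π : G.Policy} {i : ι} {h : List A} (hh : h ∈ G.hist) {x : X}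
    (hx : G.info h = some x) (hr : π.reachOpp i h ≠ 0) : 0 < π.openCount i x := by
  classical
  exact Nat.cast_pos.2 (Finset.card_pos.2 ⟨h, by simp [hh, hx, hr]⟩)

theorem Policy.Interior.openCount_eq {π : G.Policy} (hπ : π.Interior) (i : ι) :
    π.openCount i = G.infoCount := by
  classical
  funext x
  unfold openCount infoCount
  congr 2
  ext h
  simp only [Finset.mem_filter]
  exact and_congr_right fun hh => and_iff_left (hπ.reachOpp_pos i hh).ne'

/-- The factor `1 / ρ^{π^{-i}}` of the transformed reward cancels the opponents' part of the reach
probability, so that the regularization is a divergence. -/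
theorem Policy.value_regReward_deviate (hrecall : G.PerfectRecall) (η : ℝ) (μ π ν : G.Policy)
    (i : ι) : G.value (G.regReward η μ) (π.deviate i ν) i =
      G.value G.baseReward (π.deviate i ν) i - η * ν.div i (π.openCount i) μ := by
  classical
  have key : ∀ h ∈ G.hist, ∑ a ∈ G.acts h, π.reachOpp i h *
      (ν.seqProb (G.ownPast i h) * (π.deviate i ν).prob h a) *
        (if G.turn h = some i then η / π.reachOpp i h *
          Real.log ((π.deviate i ν).prob h a / μ.prob h a) else 0) =
      ∑ x with G.owner x = i, if G.info h = some x ∧ π.reachOpp i h ≠ 0 then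
        η * (ν.infoReach x * ν.infoKL μ x) else 0 := by
    intro h hh
    by_cases ht : G.turn h = some i
    · obtain ⟨x, hx, rfl⟩ := turn_eq_some_iff.1 ht
      rw [Finset.sum_eq_single_of_mem x (by simp)
        fun y _ hy => if_neg fun h => hy (Option.some.inj (h.1.symm.trans hx))]
      rw [acts_eq_legal hh hx]
      simp only [ht, if_true, hx, true_and, prob, deviate_of_owner _ _ rfl,
        hrecall.ownPast_eq hh hx]
      split_ifs with h0
      · unfold infoKL infoReach
        rw [Finset.mul_sum, Finset.mul_sum]
        refine Finset.sum_congr rfl fun a _ => ?_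
        field_simp
      · rw [not_not] at h0
        simp [h0]
    · simp only [ht, if_false, mul_zero, Finset.sum_const_zero]
      refine (Finset.sum_eq_zero fun x hx => if_neg fun h => ht ?_).symm
      exact turn_eq_some_iff.2 ⟨x, h.1, (Finset.mem_filter.1 hx).2⟩
  rw [value_deviate, value_deviate, eq_sub_iff_add_eq, ← eq_sub_iff_add_eq',
    ← Finset.sum_sub_distrib]
  calc η * ν.div i (π.openCount i) μ = ∑ h ∈ G.hist, ∑ x with G.owner x = i,
        if G.info h = some x ∧ π.reachOpp i h ≠ 0 then
          η * (ν.infoReach x * ν.infoKL μ x) else 0 := by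
        rw [Finset.sum_comm, div, Finset.mul_sum]
        refine Finset.sum_congr rfl fun x _ => ?_
        rw [← Finset.sum_filter, Finset.sum_const, nsmul_eq_mul, openCount]
        ring
    _ = _ := by
        refine Finset.sum_congr rfl fun h hh => ?_
        rw [← key h hh, ← Finset.sum_sub_distrib]
        refine Finset.sum_congr rfl fun a _ => ?_
        simp only [baseReward, regReward, reachOpp_deviate]
        ring

theorem isNash_regReward_iff (hrecall : G.PerfectRecall) (η : ℝ) (μ π : G.Policy) :
    G.IsNash (G.regReward η μ) π ↔
      ∀ i, Policy.IsRegBestResponse η (π.openCount i) μ π i := by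
  refine forall_congr' fun i => forall_congr' fun ν => ?_
  have h := Policy.value_regReward_deviate hrecall η μ π π i
  rw [Policy.deviate_self] at h
  rw [h, Policy.value_regReward_deviate hrecall]

/-- Regularized equilibria are interior: by induction along a history, every history is reached,
and the logarithm deters from excluding any action at a history that is reached. -/
theorem Policy.interior_of_isRegBestResponse (hrecall : G.PerfectRecall) {η : ℝ} (hη : 0 < η)
    {w : ι → X → ℝ} (hw : ∀ i x, 0 ≤ w i x) {μ π : G.Policy} (hμ : μ.Interior)
    (hwpos : ∀ i, ∀ h ∈ G.hist, ∀ x, G.info h = some x → π.reachOpp i h ≠ 0 → 0 < w i x)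
    (hπ : ∀ i, IsRegBestResponse η (w i) μ π i) : π.Interior := by
  have hloc : ∀ h ∈ G.hist, π.reach h ≠ 0 → ∀ x, G.info h = some x → ∀ a ∈ G.legal x,
      0 < π.1 x a := by
    intro h hh hr x hx a ha
    refine (hπ (G.owner x)).pos hrecall hη (hw _) hμ rfl (hwpos _ h hh x hx ?_)
      (infoReach_pos_of_reach_ne_zero hrecall hh hx hr) ha
    rw [reach_eq _ (G.owner x)] at hr
    exact left_ne_zero_of_mul hr
  have hreach : ∀ h ∈ G.hist, π.reach h ≠ 0 := by
    intro h hh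
    induction h with
    | nil => simp [reach]
    | cons a h ih =>
      have hh' := G.prefix_mem a h hh
      refine mul_ne_zero (ih hh') (ne_of_gt ?_)
      cases hx : G.info h with
      | none => simpa [prob, hx] using G.chance_pos h hh' hx a hh
      | some x =>
        simpa [prob, hx] using hloc h hh' (ih hh') x hx a ((G.mem_legal_iff h hh' x hx a).2 hh)
  intro x a ha
  obtain ⟨h, hh, hx⟩ := G.info_surj x
  exact hloc h hh (hreach h hh) x hx a ha

theorem isNash_regReward_iff_interior_and (hrecall : G.PerfectRecall) {η : ℝ} (hη : 0 < η)
    {μ : G.Policy} (hμ : μ.Interior) (π : G.Policy) :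
    G.IsNash (G.regReward η μ) π ↔
      π.Interior ∧ ∀ i, Policy.IsRegBestResponse η G.infoCount μ π i := by
  rw [isNash_regReward_iff hrecall]
  constructor
  · intro h
    have hint := Policy.interior_of_isRegBestResponse hrecall hη
      (fun i x => π.openCount_nonneg i x) hμ
      (fun i h hh x hx hr => Policy.openCount_pos hh hx hr) h
    exact ⟨hint, fun i => by simpa [hint.openCount_eq i] using h i⟩
  · rintro ⟨hint, h⟩ i
    simpa [hint.openCount_eq i] using h i

theorem Monotone.exists_isNash_regReward (hrecall : G.PerfectRecall) (hmono : G.Monotone)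
    {η : ℝ} (hη : 0 < η) {μ : G.Policy} (hμ : μ.Interior) :
    ∃ π, G.IsNash (G.regReward η μ) π := by
  obtain ⟨π, hπ⟩ := hmono.exists_isRegBestResponse hrecall hη.le
    (fun x => (G.infoCount_pos x).le) hμ
  exact ⟨π, (isNash_regReward_iff_interior_and hrecall hη hμ π).2
    ⟨Policy.interior_of_isRegBestResponse hrecall hη (fun _ x => (G.infoCount_pos x).le) hμ
      (fun _ _ _ x _ _ => G.infoCount_pos x) hπ, hπ⟩⟩

/-- In a monotone game the sum of the players' gains, when each of them moves from `π` to `σ`, and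
of their gains when each of them moves back from `σ`, is nonnegative. -/
theorem Monotone.sum_gain_add_sum_gain_nonneg (hmono : G.Monotone) (π σ : G.Policy) :
    0 ≤ ∑ i, (G.value G.baseReward (π.deviate i σ) i - G.value G.baseReward π i) +
      ∑ i, (G.value G.baseReward (σ.deviate i π) i - G.value G.baseReward σ i) := by
  have h := hmono.sum_omega_le π σ
  rw [← Finset.sum_add_distrib]
  have h1 : ∑ i, (G.value G.baseReward (π.deviate i σ) i - G.value G.baseReward π i +
      (G.value G.baseReward (σ.deviate i π) i - G.value G.baseReward σ i)) =
      - ∑ i, G.omega i π σ := by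
    rw [← Finset.sum_neg_distrib]
    exact Finset.sum_congr rfl fun i _ => by rw [omega]; ring
  linarith

/-- The sum over the players of the divergences of their policies. -/
noncomputable def Policy.totalDiv (π μ : G.Policy) : ℝ := ∑ i, π.div i G.infoCount μ

theorem Policy.Interior.totalDiv_nonneg {μ : G.Policy} (hμ : μ.Interior) (π : G.Policy) :
    0 ≤ π.totalDiv μ :=
  Finset.sum_nonneg fun i _ => hμ.div_nonneg (fun x => (G.infoCount_pos x).le) π i

theorem Policy.totalDiv_self (π : G.Policy) : π.totalDiv π = 0 :=
  Finset.sum_eq_zero fun i _ => div_self i _ π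

theorem Policy.Interior.eq_of_totalDiv_le_zero (hrecall : G.PerfectRecall) {π μ : G.Policy}
    (hμ : μ.Interior) (h : π.totalDiv μ ≤ 0) : π = μ := by
  have hnn := fun i => hμ.div_nonneg (fun x => (G.infoCount_pos x).le) π i
  have h0 := le_antisymm h (hμ.totalDiv_nonneg π)
  exact hμ.eq_of_div_eq_zero hrecall G.infoCount_pos fun i =>
    (Finset.sum_eq_zero_iff_of_nonneg fun i _ => hnn i).1 h0 i (Finset.mem_univ i)

theorem Policy.Interior.tendsto_totalDiv {β : Type*} {l : Filter β} {f g : β → G.Policy}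
    {π μ : G.Policy} (hμ : μ.Interior) (hf : Tendsto f l (𝓝 π)) (hg : Tendsto g l (𝓝 μ)) :
    Tendsto (fun b => (f b).totalDiv (g b)) l (𝓝 (π.totalDiv μ)) :=
  tendsto_finsetSum _ fun i _ => hμ.tendsto_div hf hg i _

/-- The variational inequality of a transformed equilibrium, for the move of player `i` to `ν`. -/
theorem IsNash.value_sub_le (hrecall : G.PerfectRecall) {η : ℝ} (hη : 0 < η) {μ π : G.Policy}
    (hμ : μ.Interior) (hπ : G.IsNash (G.regReward η μ) π) (ν : G.Policy) (i : ι) :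
    G.value G.baseReward (π.deviate i ν) i - G.value G.baseReward π i ≤
      η * (ν.div i G.infoCount μ - π.div i G.infoCount μ - ν.div i G.infoCount π) := by
  obtain ⟨hint, h⟩ := (isNash_regReward_iff_interior_and hrecall hη hμ π).1 hπ
  exact (h i).value_sub_le hrecall hη.le (fun x => (G.infoCount_pos x).le) hμ hint ν

theorem IsNash.sum_value_sub_le (hrecall : G.PerfectRecall) {η : ℝ} (hη : 0 < η) {μ π : G.Policy}
    (hμ : μ.Interior) (hπ : G.IsNash (G.regReward η μ) π) (ν : G.Policy) :
    ∑ i, (G.value G.baseReward (π.deviate i ν) i - G.value G.baseReward π i) ≤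
      η * (ν.totalDiv μ - π.totalDiv μ - ν.totalDiv π) := by
  simp only [Policy.totalDiv]
  rw [← Finset.sum_sub_distrib, ← Finset.sum_sub_distrib, Finset.mul_sum]
  exact Finset.sum_le_sum fun i _ => IsNash.value_sub_le hrecall hη hμ hπ ν i

theorem Monotone.eq_of_isNash_regReward (hrecall : G.PerfectRecall) (hmono : G.Monotone)
    {η : ℝ} (hη : 0 < η) {μ : G.Policy} (hμ : μ.Interior) {π σ : G.Policy}
    (hπ : G.IsNash (G.regReward η μ) π) (hσ : G.IsNash (G.regReward η μ) σ) : π = σ := by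
  have hπi := ((isNash_regReward_iff_interior_and hrecall hη hμ π).1 hπ).1
  have hσi := ((isNash_regReward_iff_interior_and hrecall hη hμ σ).1 hσ).1
  have h1 := IsNash.sum_value_sub_le hrecall hη hμ hπ σ
  have h2 := IsNash.sum_value_sub_le hrecall hη hμ hσ π
  have h3 := hmono.sum_gain_add_sum_gain_nonneg π σ
  have h4 : 0 ≤ η * (-(σ.totalDiv π) - π.totalDiv σ) := by linarith
  have h5 := nonneg_of_mul_nonneg_right h4 hη
  exact hσi.eq_of_totalDiv_le_zero hrecall (by linarith [hπi.totalDiv_nonneg σ])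

theorem interior_uniform : G.uniform.Interior := by
  intro x a ha
  have : 0 < (G.legal x).card := Finset.card_pos.2 (G.legal_nonempty x)
  simp only [uniform, ha, if_true]
  positivity

theorem Monotone.exists_isNash_baseReward (hrecall : G.PerfectRecall) (hmono : G.Monotone) :
    ∃ π, G.IsNash G.baseReward π := by
  obtain ⟨π, hπ⟩ := hmono.exists_isRegBestResponse hrecall le_rfl
    (fun x => (G.infoCount_pos x).le) interior_uniform
  exact ⟨π, fun i ν => by simpa using hπ i ν⟩

/-! ### Convergence of the iteration -/

/-- One step towards a transformed equilibrium decreases the divergence of every Nash equilibrium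
by at least the divergence of the step. -/
theorem Monotone.totalDiv_le (hrecall : G.PerfectRecall) (hmono : G.Monotone) {η : ℝ}
    (hη : 0 < η) {μ π ν : G.Policy} (hμ : μ.Interior) (hπ : G.IsNash (G.regReward η μ) π)
    (hν : G.IsNash G.baseReward ν) : ν.totalDiv π ≤ ν.totalDiv μ - π.totalDiv μ := by
  have h1 := IsNash.sum_value_sub_le hrecall hη hμ hπ ν
  have h2 := hmono.sum_gain_add_sum_gain_nonneg π ν
  have h3 : ∑ i, (G.value G.baseReward (ν.deviate i π) i - G.value G.baseReward ν i) ≤ 0 :=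
    Finset.sum_nonpos fun i _ => sub_nonpos.2 (hν i π)
  have h4 : 0 ≤ η * (ν.totalDiv μ - π.totalDiv μ - ν.totalDiv π) := by linarith
  have h5 := nonneg_of_mul_nonneg_right h4 hη
  linarith

/-- Cluster points of policies at bounded divergence from an interior policy are interior. -/
theorem Policy.Interior.interior_of_tendsto (hrecall : G.PerfectRecall) {ν : G.Policy}
    (hν : ν.Interior) {C : ℝ} {f : ℕ → G.Policy} (hf : ∀ k, (f k).Interior)
    (hC : ∀ k, ν.totalDiv (f k) ≤ C) {π : G.Policy} (hπ : Tendsto f atTop (𝓝 π)) :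
    π.Interior := by
  intro x a ha
  have hR := hν.infoReach_pos hrecall x
  have hc := G.infoCount_pos x
  have hw : ∀ x, 0 ≤ G.infoCount x := fun x => (G.infoCount_pos x).le
  have h1 : ∀ k, ν.infoKL (f k) x ≤ C / (G.infoCount x * ν.infoReach x) := by
    intro k
    rw [le_div_iff₀ (by positivity)]
    have h2 : G.infoCount x * (ν.infoReach x * ν.infoKL (f k) x) ≤
        ν.div (G.owner x) G.infoCount (f k) :=
      Finset.single_le_sum (f := fun x => G.infoCount x * (ν.infoReach x * ν.infoKL (f k) x))
        (fun y _ => (hf k).div_term_nonneg hw ν y) (by simp)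
    have h3 : ν.div (G.owner x) G.infoCount (f k) ≤ ν.totalDiv (f k) :=
      Finset.single_le_sum (f := fun i => ν.div i G.infoCount (f k))
        (fun i _ => (hf k).div_nonneg hw ν i) (Finset.mem_univ _)
    linarith [hC k]
  exact lt_of_lt_of_le (mul_pos (hν x a ha) (Real.exp_pos _))
    (ge_of_tendsto' (tendsto_policy.1 hπ x a) fun k =>
      mul_exp_le_of_infoKL_le (hf k x) (h1 k) ha (hν x a ha))

/-- A sequence of interior policies, each a transformed equilibrium with respect to the one before,
converges to a Nash equilibrium, provided that the Nash equilibria are interior. -/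
theorem Monotone.exists_tendsto (hrecall : G.PerfectRecall) (hmono : G.Monotone)
    (hint : ∀ π : G.Policy, G.IsNash G.baseReward π → π.Interior) {η : ℝ} (hη : 0 < η)
    {p : ℕ → G.Policy} (hp : ∀ k, (p k).Interior)
    (hstep : ∀ k, G.IsNash (G.regReward η (p k)) (p (k + 1))) :
    ∃ π, G.IsNash G.baseReward π ∧ Tendsto p atTop (𝓝 π) := by
  have hdecr : ∀ ν, G.IsNash G.baseReward ν → ∀ k,
      ν.totalDiv (p (k + 1)) ≤ ν.totalDiv (p k) - (p (k + 1)).totalDiv (p k) := fun ν hν k =>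
    hmono.totalDiv_le hrecall hη (hp k) (hstep k) hν
  have hanti : ∀ ν, G.IsNash G.baseReward ν → Antitone fun k => ν.totalDiv (p k) :=
    fun ν hν => antitone_nat_of_succ_le fun k => by
      linarith [hdecr ν hν k, (hp k).totalDiv_nonneg (p (k + 1))]
  obtain ⟨ν, hν⟩ := hmono.exists_isNash_baseReward hrecall
  have hclint : ∀ φ : ℕ → ℕ, ∀ π, Tendsto (fun j => p (φ j)) atTop (𝓝 π) → π.Interior :=
    fun φ π h => (hint ν hν).interior_of_tendsto hrecall (fun j => hp (φ j))
      (fun j => hanti ν hν (Nat.zero_le (φ j))) h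
  -- the steps become small in divergence
  have hsmall : Tendsto (fun k => (p (k + 1)).totalDiv (p k)) atTop (𝓝 0) := by
    have h1 : Tendsto (fun k => ν.totalDiv (p k)) atTop (𝓝 (⨅ k, ν.totalDiv (p k))) :=
      tendsto_atTop_ciInf (hanti ν hν) ⟨0, by rintro _ ⟨k, rfl⟩; exact (hp k).totalDiv_nonneg ν⟩
    have h2 := h1.sub (h1.comp (tendsto_add_atTop_nat 1))
    rw [sub_self] at h2
    refine squeeze_zero (fun k => (hp k).totalDiv_nonneg _) (fun k => ?_) h2
    have := hdecr ν hν k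
    simp only [Function.comp_apply]
    linarith
  -- a subsequence along which both `p k` and `p (k + 1)` converge
  obtain ⟨⟨π, σ⟩, -, φ, hφ, hlim⟩ := isCompact_univ.tendsto_subseq
    (x := fun k => (p k, p (k + 1))) fun k => Set.mem_univ _
  have hlim1 : Tendsto (fun j => p (φ j)) atTop (𝓝 π) := (continuous_fst.tendsto _).comp hlim
  have hlim2 : Tendsto (fun j => p (φ j + 1)) atTop (𝓝 σ) := (continuous_snd.tendsto _).comp hlim
  have hπi := hclint φ π hlim1
  have hσπ : σ = π := hπi.eq_of_totalDiv_le_zero hrecall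
    (tendsto_nhds_unique (hπi.tendsto_totalDiv hlim2 hlim1)
      (hsmall.comp hφ.tendsto_atTop)).le
  subst hσπ
  -- the variational inequalities pass to the limit
  have hπN : G.IsNash G.baseReward σ := by
    intro i τ
    have hl : Tendsto (fun j => G.value G.baseReward ((p (φ j + 1)).deviate i τ) i -
        G.value G.baseReward (p (φ j + 1)) i) atTop
        (𝓝 (G.value G.baseReward (σ.deviate i τ) i - G.value G.baseReward σ i)) := by
      have hdev : Continuous fun π : G.Policy => G.value G.baseReward (π.deviate i τ) i :=
        (continuous_value i).comp
          ((Policy.continuous_deviate i).comp (continuous_id.prodMk continuous_const))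
      exact ((hdev.tendsto σ).comp hlim2).sub (((continuous_value i).tendsto σ).comp hlim2)
    have hr : Tendsto (fun j => η * (τ.div i G.infoCount (p (φ j)) -
        (p (φ j + 1)).div i G.infoCount (p (φ j)) - τ.div i G.infoCount (p (φ j + 1)))) atTop
        (𝓝 (η * (τ.div i G.infoCount σ - σ.div i G.infoCount σ - τ.div i G.infoCount σ))) :=
      (((hπi.tendsto_div tendsto_const_nhds hlim1 i _).sub
        (hπi.tendsto_div hlim2 hlim1 i _)).sub
        (hπi.tendsto_div tendsto_const_nhds hlim2 i _)).const_mul η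
    have h := le_of_tendsto_of_tendsto' hl hr fun j =>
      IsNash.value_sub_le hrecall hη (hp (φ j)) (hstep (φ j)) τ i
    rw [Policy.div_self] at h
    linarith
  -- the divergence of the limit decreases to zero along the whole sequence
  have hzero : Tendsto (fun k => σ.totalDiv (p k)) atTop (𝓝 0) := by
    have h1 : Tendsto (fun k => σ.totalDiv (p k)) atTop (𝓝 (⨅ k, σ.totalDiv (p k))) :=
      tendsto_atTop_ciInf (hanti σ hπN) ⟨0, by rintro _ ⟨k, rfl⟩; exact (hp k).totalDiv_nonneg σ⟩
    have h2 := hπi.tendsto_totalDiv (tendsto_const_nhds (x := σ)) hlim1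
    rw [Policy.totalDiv_self] at h2
    rwa [tendsto_nhds_unique (h1.comp hφ.tendsto_atTop) h2] at h1
  refine ⟨σ, hπN, tendsto_of_subseq_tendsto fun ψ hψ => ?_⟩
  obtain ⟨τ, -, θ, hθ, hτ⟩ := isCompact_univ.tendsto_subseq
    (x := fun k => p (ψ k)) fun k => Set.mem_univ _
  have hτi := hclint (ψ ∘ θ) τ hτ
  have h1 := hτi.tendsto_totalDiv (tendsto_const_nhds (x := σ)) hτ
  have h2 := hzero.comp (hψ.comp hθ.tendsto_atTop)
  have h3 : σ = τ := hτi.eq_of_totalDiv_le_zero hrecall (tendsto_nhds_unique h1 h2).le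
  exact ⟨θ, h3 ▸ hτ⟩

end SeqGame

open SeqGame in
theorem mainTheorem1 {ι X A : Type*} [Fintype ι] [DecidableEq ι] [Fintype X] [Fintype A]
    [DecidableEq A] (G : SeqGame ι X A) (hrecall : G.PerfectRecall) (hmono : G.Monotone)
    (hint : ∀ π : G.Policy, G.IsNash G.baseReward π → π.Interior)
    (η : ℝ) (hη : 0 < η) :
    ∃ F : G.Policy → G.Policy,
      (∀ μ : G.Policy, μ.Interior →
        (F μ).Interior ∧ ∀ π : G.Policy, G.IsNash (G.regReward η μ) π ↔ π = F μ) ∧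
      ∃ πstar : G.Policy, G.IsNash G.baseReward πstar ∧
        Tendsto (fun k : ℕ => F^[k] G.uniform) atTop (𝓝 πstar) := by
  have key : ∀ μ : G.Policy, ∃ σ : G.Policy, μ.Interior →
      σ.Interior ∧ ∀ π : G.Policy, G.IsNash (G.regReward η μ) π ↔ π = σ := by
    intro μ
    by_cases hμ : μ.Interior
    · obtain ⟨σ, hσ⟩ := hmono.exists_isNash_regReward hrecall hη hμ
      refine ⟨σ, fun _ => ⟨((isNash_regReward_iff_interior_and hrecall hη hμ σ).1 hσ).1,
        fun π => ⟨fun hπ => hmono.eq_of_isNash_regReward hrecall hη hμ hπ hσ, ?_⟩⟩⟩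
      rintro rfl
      exact hσ
    · exact ⟨μ, fun h => absurd h hμ⟩
  choose F hF using key
  have hp : ∀ k : ℕ, (F^[k] G.uniform).Interior := by
    intro k
    induction k with
    | zero => exact interior_uniform
    | succ k ih =>
      rw [Function.iterate_succ_apply']
      exact (hF _ ih).1
  refine ⟨F, hF, hmono.exists_tendsto hrecall hint hη hp fun k => ?_⟩
  rw [Function.iterate_succ_apply']
  exact ((hF _ (hp k)).2 _).2 rfl
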